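/- For an integer $l\ge 1$ and $k=(k_1,\dots,k_l)\in\mathbb Z^l$ put $$\kappa(k_1,\dots,k_l)=k_1^2+k_2^2+\cdots+k_l^2-k_1k_2-k_2k_3-\cdots-k_{l-1}k_l ,$$ and let $\varphi(q)=\prod_{j\ge 1}(1-q^j)$ be Euler's product. Let $m$ be a positive integer, and for $k\in\mathbb Z^{4m-1}$ put $$\widetilde{lin}(k)=-3k_1-\cdots-3k_{m-1}+(3m-2)k_m-k_{m+1}-\cdots-k_{4m-2}+(3m-1)k_{4m-1}.$$ Then $3m\,\kappa(k)+\widetilde{lin}(k)\ge 0$ for all $k\in\mathbb Z^{4m-1}$, and $$\sum_{k\in\mathbb Z^{4m-1}} q^{\,3m\,\kappa(k)+\widetilde{lin}(k)}=\frac{\varphi(q^{3m})^{4m}\,\varphi(q^2)^2}{\varphi(q)^2\,\varphi(q^3)},$$ both as an identity in $\mathbb C[[q]]$ (with coefficientwise convergence) and, with absolute convergence of the series, for every complex number $q$ with $|q|<1$. Moreover, for $m=1$ this identity coincides, exponent by exponent and product side by product side, with the case $m=1$ of the identity $$\sum_{k\in\mathbb Z^{4m-1}} q^{\,(4m-1)\kappa(k)+lin(k)}=\frac{\varphi(q^{4m-1})^{4m-1}\,\varphi(q^{2m})^2}{\varphi(q)\,\varphi(q^m)},$$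 where $lin(k)=(2m-1)k_1-k_2-\cdots-k_{3m-1}+(4m-2)k_{3m}-k_{3m+1}-\cdots-k_{4m-1}$. -/

import Mathlib

open scoped PowerSeries PowerSeries.WithPiTopology

noncomputable section

namespace GaussSeries

/-- Euler's product `φ(q) = ∏_{j ≥ 1} (1 - q ^ j)`, in any commutative topological ring. It is used
for complex numbers `q` with `‖q‖ < 1` and for positive powers of the variable of `ℂ⟦X⟧`
(with coefficientwise convergence). -/
def eulerPhi {R : Type*} [CommRing R] [TopologicalSpace R] (q : R) : R :=
  ∏' j : ℕ, (1 - q ^ (j + 1))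

/-- `κ(k_1, …, k_l) = k_1² + ⋯ + k_l² - k_1 k_2 - ⋯ - k_{l-1} k_l`; the variable `k_j` is the value
of `k` at the (zero-based) index `j - 1`. -/
def kappa {l : ℕ} (k : Fin l → ℤ) : ℤ :=
  ∑ i : Fin l, k i ^ 2 -
    ∑ i : Fin (l - 1), k ⟨(i : ℕ), by omega⟩ * k ⟨(i : ℕ) + 1, by omega⟩

/-- The coefficient of `k_j` (with `1 ≤ j ≤ 4m - 1`) in the linear form of the class
`GAUSS(n = 1 + (4m - 1), Λ_{3m})`. -/
def linCoeff (m j : ℕ) : ℤ :=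
  if j = 1 then 2 * (m : ℤ) - 1 else if j = 3 * m then 4 * (m : ℤ) - 2 else -1

/-- `lin(k) = (2m-1) k_1 - k_2 - ⋯ - k_{3m-1} + (4m-2) k_{3m} - k_{3m+1} - ⋯ - k_{4m-1}`. -/
def lin (m : ℕ) (k : Fin (4 * m - 1) → ℤ) : ℤ :=
  ∑ i : Fin (4 * m - 1), linCoeff m ((i : ℕ) + 1) * k i

/-- The coefficient of `k_j` (with `1 ≤ j ≤ 4m - 1`) in the linear form of the class
`GAUSS(n = m + 3m, Λ_{4m-1})`. -/
def linTildeCoeff (m j : ℕ) : ℤ :=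
  if j < m then -3
  else if j = m then 3 * (m : ℤ) - 2
  else if j < 4 * m - 1 then -1
  else 3 * (m : ℤ) - 1

/-- `lin~(k) = -3 k_1 - ⋯ - 3 k_{m-1} + (3m-2) k_m - k_{m+1} - ⋯ - k_{4m-2} + (3m-1) k_{4m-1}`. -/
def linTilde (m : ℕ) (k : Fin (4 * m - 1) → ℤ) : ℤ :=
  ∑ i : Fin (4 * m - 1), linTildeCoeff m ((i : ℕ) + 1) * k i

/-- The exponent of `q` in the class `GAUSS(n = 1 + (4m - 1), Λ_{3m})`. -/
def firstExponent (m : ℕ) (k : Fin (4 * m - 1) → ℤ) : ℤ :=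
  (4 * (m : ℤ) - 1) * kappa k + lin m k

/-- The exponent of `q` in the class `GAUSS(n = m + 3m, Λ_{4m-1})`. -/
def secondExponent (m : ℕ) (k : Fin (4 * m - 1) → ℤ) : ℤ :=
  3 * (m : ℤ) * kappa k + linTilde m k

/-- The product side `φ(q^{4m-1})^{4m-1} φ(q^{2m})² / (φ(q) φ(q^m))`. -/
def firstProduct {R : Type*} [CommRing R] [TopologicalSpace R] [Inv R] (m : ℕ) (q : R) : R :=
  eulerPhi (q ^ (4 * m - 1)) ^ (4 * m - 1) * eulerPhi (q ^ (2 * m)) ^ 2 *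
    (eulerPhi q * eulerPhi (q ^ m))⁻¹

/-- The product side `φ(q^{3m})^{4m} φ(q²)² / (φ(q)² φ(q³))`. -/
def secondProduct {R : Type*} [CommRing R] [TopologicalSpace R] [Inv R] (m : ℕ) (q : R) : R :=
  eulerPhi (q ^ (3 * m)) ^ (4 * m) * eulerPhi (q ^ 2) ^ 2 *
    (eulerPhi q ^ 2 * eulerPhi (q ^ 3))⁻¹

end GaussSeries

end

namespace GaussSeries

open Filter Topology Finset MeasureTheory

/-! ### Jacobi's triple product -/

/-! The quadratic form is that of the root lattice `A_{4m-1}`. In the coordinates `x_j = k_{j+1} -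
k_j`, which fill the hyperplane `∑ x_j = 0` in `ℤ^{4m}`, one has `κ = ∑ x_j (x_j - 1) / 2`, and
`lin~` becomes `∑ w_j x_j` with weights `2, 5, …, 3m-1` and `1, …, 3m-1, 0` (`secondExponent_eq`).
Hence the exponent is a sum of nonnegative one-variable terms, and the series is the constant term
in `z` of a product of `4m` Jacobi theta functions of base `q^{3m}` at `z q^{w_j}`.

By the triple product (`hasSum_jacobi`) and sorting of factors into residue classes
(`prod_jacobiProd`), the weights `0, …, 3m-1` merge into one theta function of base `q` at `z`, and
the weights `2 + 3i` into one of base `q³` at `z q²`, up to the constant `φ(q^{3m})^{4m} / (φ(q)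
φ(q³))`. The constant term of the product of these two is `∑_a q^{4 a(a-1)/2 + a}`, Gauss's
triangular number series, equal to `φ(q²)² / φ(q)` (`jacobiProd_four`).

Constant terms are taken by integration over `|z| = 1`, for a fixed `q` with `0 < |q| < 1`. The
formal identity follows from uniqueness of power series after clearing denominators, and its
coefficient of `q^0` then settles `q = 0`. -/

/-- The finite product `(1 - q) (1 - q ^ 2) ⋯ (1 - q ^ n)`. -/
noncomputable def eulerProd (q : ℂ) (n : ℕ) : ℂ := ∏ i ∈ range n, (1 - q ^ (i + 1))

/-- The `q`-binomial coefficient, with value zero for `r > n`. -/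
noncomputable def qBinom (q : ℂ) (n r : ℕ) : ℂ :=
  if r ≤ n then eulerProd q n / (eulerProd q r * eulerProd q (n - r)) else 0

theorem one_sub_pow_ne_zero {q : ℂ} (hq : ‖q‖ < 1) (n : ℕ) : 1 - q ^ (n + 1) ≠ 0 := by
  intro h
  have h1 : ‖q ^ (n + 1)‖ = 1 := by rw [← sub_eq_zero.mp h, norm_one]
  rw [norm_pow] at h1
  exact (pow_lt_one₀ (norm_nonneg q) hq n.succ_ne_zero).ne h1

theorem eulerProd_ne_zero {q : ℂ} (hq : ‖q‖ < 1) (n : ℕ) : eulerProd q n ≠ 0 :=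
  prod_ne_zero_iff.mpr fun i _ => one_sub_pow_ne_zero hq i

theorem eulerProd_succ (q : ℂ) (n : ℕ) :
    eulerProd q (n + 1) = eulerProd q n * (1 - q ^ (n + 1)) := prod_range_succ _ _

theorem qBinom_zero_right {q : ℂ} (hq : ‖q‖ < 1) (n : ℕ) : qBinom q n 0 = 1 := by
  have := eulerProd_ne_zero hq n
  simpa [qBinom, eulerProd] using this

theorem qBinom_of_lt (q : ℂ) {n r : ℕ} (h : n < r) : qBinom q n r = 0 := if_neg (by omega)

/-- Over a common denominator this is `1 - q^{n+1} = (1 - q^{n-r}) + q^{n-r} (1 - q^{r+1})`. The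
case `r = n` is separate because `qBinom q n (r + 1)` is then zero by convention. -/
theorem qBinom_succ_succ {q : ℂ} (hq : ‖q‖ < 1) {n r : ℕ} (h : r ≤ n) :
    qBinom q (n + 1) (r + 1) = qBinom q n (r + 1) + q ^ (n - r) * qBinom q n r := by
  obtain ⟨s, rfl⟩ := Nat.exists_eq_add_of_le h
  have hr := eulerProd_ne_zero hq r
  have hr1 := one_sub_pow_ne_zero hq r
  rcases s with _ | s
  · rw [qBinom_of_lt q (show r + 0 < r + 1 by omega)]
    have h1 := eulerProd_ne_zero hq (r + 1)
    simp [qBinom, eulerProd] at *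
    rw [div_self h1, div_self hr]
  · have hs := eulerProd_ne_zero hq s
    have hs1 := one_sub_pow_ne_zero hq s
    rw [qBinom, qBinom, qBinom, if_pos (by omega), if_pos (by omega), if_pos (by omega),
      show r + (s + 1) + 1 - (r + 1) = s + 1 by omega, show r + (s + 1) - (r + 1) = s by omega,
      show r + (s + 1) - r = s + 1 by omega, eulerProd_succ q (r + (s + 1)), eulerProd_succ q r,
      eulerProd_succ q s]
    field_simp
    ring

/-- The `q`-binomial theorem. -/
theorem prod_one_add_mul_pow {q : ℂ} (hq : ‖q‖ < 1) (w : ℂ) (n : ℕ) :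
    ∏ i ∈ range n, (1 + w * q ^ i) =
      ∑ r ∈ range (n + 1), qBinom q n r * q ^ (r.choose 2) * w ^ r := by
  induction n with
  | zero => simp [qBinom_zero_right hq]
  | succ n ih =>
    -- The factor `1 + w q^n` produces two copies of the sum; shifting the index in one of them,
    -- with a vanishing top term, aligns them for the Pascal rule.
    have hzero : ∑ r ∈ range (n + 1), qBinom q n r * q ^ (r.choose 2) * w ^ r =
        ∑ r ∈ range (n + 1), qBinom q n (r + 1) * q ^ ((r + 1).choose 2) * w ^ (r + 1) + 1 := by
      have h := sum_range_succ' (fun r => qBinom q n r * q ^ (r.choose 2) * w ^ r) (n + 1)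
      rw [sum_range_succ, qBinom_of_lt q (show n < n + 1 by omega)] at h
      simpa [qBinom_zero_right hq] using h
    rw [prod_range_succ, sum_range_succ', mul_add, mul_one]
    nth_rewrite 1 [ih]
    rw [hzero, ih, sum_mul, qBinom_zero_right hq]
    have hterm : ∀ r ∈ range (n + 1),
        qBinom q (n + 1) (r + 1) * q ^ ((r + 1).choose 2) * w ^ (r + 1) =
          qBinom q n (r + 1) * q ^ ((r + 1).choose 2) * w ^ (r + 1) +
            qBinom q n r * q ^ (r.choose 2) * w ^ r * (w * q ^ n) := by
      intro r hr
      have hr' : r ≤ n := by simpa [Nat.lt_succ_iff] using hr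
      rw [qBinom_succ_succ hq hr', Nat.choose_succ_succ' r 1, Nat.choose_one_right]
      conv_rhs => rw [show q ^ n = q ^ (n - r) * q ^ r by rw [← pow_add, Nat.sub_add_cancel hr']]
      ring
    rw [sum_congr rfl hterm, sum_add_distrib]
    simp
    ring

/-- The exponent `a (a - 1) / 2`, an integer for every integer `a`. -/
def tri (a : ℤ) : ℤ := a * (a - 1) / 2

theorem two_mul_tri (a : ℤ) : 2 * tri a = a * (a - 1) :=
  Int.mul_ediv_cancel' (by
    rw [mul_comm]
    exact (even_iff_two_dvd).mp (by simpa using Int.even_mul_succ_self (a - 1)))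

theorem tri_natCast (n : ℕ) : tri n = (n.choose 2 : ℕ) := by
  have h := two_mul_tri n
  have h2 : (2 * n.choose 2 : ℕ) = n * (n - 1) := by
    rw [Nat.choose_two_right, Nat.mul_div_cancel' (Nat.even_mul_pred_self n).two_dvd]
  rcases n with _ | n
  · simp [tri]
  · have h3 : (2 * ((n + 1).choose 2 : ℕ) : ℤ) = (n + 1) * n := by exact_mod_cast h2
    push_cast at h ⊢
    linarith

theorem tri_add (a b : ℤ) : tri (a + b) = tri a + tri b + a * b := by
  have h1 := two_mul_tri (a + b)
  have h2 := two_mul_tri a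
  have h3 := two_mul_tri b
  linarith

theorem tri_nonneg (a : ℤ) : 0 ≤ tri a := by
  have h := two_mul_tri a
  rcases le_or_gt a 0 with ha | ha <;> nlinarith

theorem tri_succ (n : ℤ) : tri (n + 1) = tri n + n := by
  rw [tri_add]; simp [tri]

theorem tri_neg (n : ℤ) : tri (-n) = tri n + n := by
  have h1 := two_mul_tri (-n)
  have h2 := two_mul_tri n
  linarith

theorem prod_mul_inv_pow {q z : ℂ} (hq0 : q ≠ 0) (n : ℕ) :
    ∏ i ∈ range n, (z * (q ^ (i + 1))⁻¹) = z ^ n * q ^ (-tri (-(n : ℤ))) := by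
  induction n with
  | zero => simp [tri]
  | succ n ih =>
    rw [prod_range_succ, ih, tri_neg, tri_neg, Nat.cast_succ, tri_succ,
      show -(tri n + (n : ℤ) + (n + 1)) = -(tri n + n) + -((n + 1 : ℕ) : ℤ) by push_cast; ring,
      zpow_add₀ hq0, zpow_neg q ((n + 1 : ℕ) : ℤ), zpow_natCast]
    ring

/-- The finite form of Jacobi's triple product. -/
theorem prod_mul_prod_eq_sum {q z : ℂ} (hq : ‖q‖ < 1) (hq0 : q ≠ 0) (hz : z ≠ 0) (n : ℕ) :
    (∏ i ∈ range n, (1 + z * q ^ i)) * ∏ i ∈ range n, (1 + z⁻¹ * q ^ (i + 1)) =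
      ∑ r ∈ range (2 * n + 1), qBinom q (2 * n) r *
        (q ^ tri ((r : ℤ) - n) * z ^ ((r : ℤ) - n)) := by
  -- The `q`-binomial theorem is used with `2n` factors and `w = z q^{-n}`. Each of the first `n`
  -- factors is turned around by `1 + z q^{-s} = z q^{-s} (1 + z⁻¹ q^s)`.
  have hsplit : ∏ i ∈ range (2 * n), (1 + z * (q ^ n)⁻¹ * q ^ i) =
      (z ^ n * q ^ (-tri (-(n : ℤ))) * ∏ i ∈ range n, (1 + z⁻¹ * q ^ (i + 1))) *
        ∏ i ∈ range n, (1 + z * q ^ i) := by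
    rw [two_mul, prod_range_add, ← prod_mul_inv_pow hq0]
    congr 1
    · rw [← prod_mul_distrib, ← prod_range_reflect]
      refine prod_congr rfl fun i hi => ?_
      have hi' : i < n := by simpa using hi
      have : q ^ n = q ^ (n - 1 - i) * q ^ (i + 1) := by
        rw [← pow_add]; congr 1; omega
      rw [this]
      field_simp
      ring
    · refine prod_congr rfl fun i _ => ?_
      rw [pow_add]
      field_simp
  have hne : z ^ n * q ^ (-tri (-(n : ℤ))) ≠ 0 :=
    mul_ne_zero (pow_ne_zero _ hz) (zpow_ne_zero _ hq0)
  apply mul_left_cancel₀ hne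
  rw [mul_sum]
  calc _ = ∏ i ∈ range (2 * n), (1 + z * (q ^ n)⁻¹ * q ^ i) := by rw [hsplit]; ring
    _ = _ := by
      rw [prod_one_add_mul_pow hq]
      refine sum_congr rfl fun r _ => ?_
      have hexp : -tri (-(n : ℤ)) + tri ((r : ℤ) - n) = (r.choose 2 : ℕ) + -((n * r : ℕ) : ℤ) := by
        rw [sub_eq_add_neg, tri_add, tri_natCast]; push_cast; ring
      have hq' : q ^ (r.choose 2) * ((q ^ n)⁻¹) ^ r =
          q ^ (-tri (-(n : ℤ))) * q ^ tri ((r : ℤ) - n) := by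
        rw [← zpow_add₀ hq0, hexp, zpow_add₀ hq0, zpow_neg, zpow_natCast, zpow_natCast, pow_mul,
          inv_pow]
      have hz' : z ^ r = z ^ n * z ^ ((r : ℤ) - n) := by
        rw [← zpow_natCast z n, ← zpow_add₀ hz, add_sub_cancel, zpow_natCast]
      rw [mul_pow]
      calc _ = qBinom q (2 * n) r * (q ^ (r.choose 2) * ((q ^ n)⁻¹) ^ r) * z ^ r := by ring
        _ = _ := by rw [hq', hz']; ring

theorem summable_norm_pow {q : ℂ} (hq : ‖q‖ < 1) {c : ℕ} (hc : 0 < c) (d : ℕ) (w : ℂ) :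
    Summable fun j : ℕ => ‖w * q ^ (c * j + d)‖ := by
  have h : Summable fun j : ℕ => (‖w‖ * ‖q‖ ^ d) * (‖q‖ ^ c) ^ j :=
    (summable_geometric_of_lt_one (by positivity)
      (pow_lt_one₀ (norm_nonneg q) hq hc.ne')).mul_left _
  refine h.congr fun j => ?_
  rw [norm_mul, norm_pow, pow_add, pow_mul]
  ring

theorem multipliable_one_add_mul_pow {q : ℂ} (hq : ‖q‖ < 1) (d : ℕ) (w : ℂ) :
    Multipliable fun j : ℕ => 1 + w * q ^ (j + d) :=
  multipliable_one_add_of_summable (by simpa using summable_norm_pow hq one_pos d w)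

theorem multipliable_one_sub_pow {q : ℂ} (hq : ‖q‖ < 1) :
    Multipliable fun j : ℕ => 1 - q ^ (j + 1) := by
  simpa [sub_eq_add_neg] using multipliable_one_add_mul_pow hq 1 (-1)

theorem eulerPhi_ne_zero {q : ℂ} (hq : ‖q‖ < 1) : eulerPhi q ≠ 0 := by
  have h := tprod_one_add_ne_zero_of_summable (f := fun j : ℕ => -q ^ (j + 1))
    (fun j => by simpa [sub_eq_add_neg] using one_sub_pow_ne_zero hq j)
    (by simpa using summable_norm_pow hq one_pos 1 1)
  simpa [eulerPhi, sub_eq_add_neg] using h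

theorem tendsto_eulerProd {q : ℂ} (hq : ‖q‖ < 1) :
    Tendsto (eulerProd q) atTop (𝓝 (eulerPhi q)) :=
  (multipliable_one_sub_pow hq).hasProd.tendsto_prod_nat

/-- The sequences `eulerProd q n` and their inverses converge, so both are bounded. The uniform
bound provides the dominating series when `n → ∞` in the finite triple product. -/
theorem exists_norm_qBinom_le {q : ℂ} (hq : ‖q‖ < 1) : ∃ C, ∀ n r, ‖qBinom q n r‖ ≤ C := by
  obtain ⟨A, hA⟩ := (Metric.isBounded_range_of_tendsto _ (tendsto_eulerProd hq)).exists_norm_le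
  obtain ⟨B, hB⟩ := (Metric.isBounded_range_of_tendsto _
    ((tendsto_eulerProd hq).inv₀ (eulerPhi_ne_zero hq))).exists_norm_le
  have hA' : ∀ n, ‖eulerProd q n‖ ≤ A := fun n => hA _ ⟨n, rfl⟩
  have hB' : ∀ n, ‖(eulerProd q n)⁻¹‖ ≤ B := fun n => hB _ ⟨n, rfl⟩
  have hA0 : 0 ≤ A := (norm_nonneg _).trans (hA' 0)
  have hB0 : 0 ≤ B := (norm_nonneg _).trans (hB' 0)
  refine ⟨A * (B * B), fun n r => ?_⟩
  unfold qBinom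
  split_ifs
  · rw [div_eq_mul_inv, mul_inv, norm_mul, norm_mul]
    exact mul_le_mul (hA' _) (mul_le_mul (hB' _) (hB' _) (norm_nonneg _) hB0)
      (by positivity) hA0
  · simpa using by positivity

theorem tendsto_qBinom {q : ℂ} (hq : ‖q‖ < 1) (k : ℤ) :
    Tendsto (fun n : ℕ => qBinom q (2 * n) ((n : ℤ) + k).toNat) atTop (𝓝 (eulerPhi q)⁻¹) := by
  have h := tendsto_eulerProd hq
  have hφ := eulerPhi_ne_zero hq
  have h1 : Tendsto (fun n : ℕ => eulerProd q (2 * n)) atTop (𝓝 (eulerPhi q)) :=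
    h.comp (tendsto_atTop_atTop.mpr fun b => ⟨b, fun a ha => by omega⟩)
  have h2 : Tendsto (fun n : ℕ => eulerProd q ((n : ℤ) + k).toNat) atTop (𝓝 (eulerPhi q)) :=
    h.comp (tendsto_atTop_atTop.mpr fun b => ⟨b + k.natAbs, fun a ha => by omega⟩)
  have h3 : Tendsto (fun n : ℕ => eulerProd q (2 * n - ((n : ℤ) + k).toNat)) atTop
      (𝓝 (eulerPhi q)) :=
    h.comp (tendsto_atTop_atTop.mpr fun b => ⟨b + k.natAbs, fun a ha => by omega⟩)
  have h4 := h1.div (h2.mul h3) (mul_ne_zero hφ hφ)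
  rw [show eulerPhi q / (eulerPhi q * eulerPhi q) = (eulerPhi q)⁻¹ by field_simp] at h4
  refine h4.congr' ?_
  filter_upwards [eventually_ge_atTop k.natAbs] with n hn
  rw [qBinom, if_pos (by omega)]
  rfl

theorem summable_pow_choose_two_mul_pow {r : ℝ} (hr0 : 0 ≤ r) (hr : r < 1) {s : ℝ} (hs : 0 < s) :
    Summable fun n : ℕ => r ^ (n.choose 2) * s ^ n := by
  rcases hr0.eq_or_lt with rfl | hr0
  · refine summable_of_ne_finset_zero (s := range 2) fun n hn => ?_
    have : 2 ≤ n := by simpa [Nat.lt_iff_add_one_le] using hn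
    rw [zero_pow (Nat.choose_pos this).ne', zero_mul]
  refine summable_of_ratio_test_tendsto_lt_one (l := 0) one_pos
    (Eventually.of_forall fun n => by positivity) ?_
  have h : Tendsto (fun n : ℕ => r ^ n * s) atTop (𝓝 (0 * s)) :=
    (tendsto_pow_atTop_nhds_zero_of_lt_one hr0.le hr).mul_const s
  rw [zero_mul] at h
  refine h.congr fun n => ?_
  rw [Real.norm_of_nonneg (by positivity), Real.norm_of_nonneg (by positivity),
    Nat.choose_succ_succ' n 1, Nat.choose_one_right, pow_add, pow_succ]
  field_simp

/-- The terms of the bilateral theta series form an absolutely summable family. -/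
theorem summable_norm_theta {q z : ℂ} (hq : ‖q‖ < 1) (hq0 : q ≠ 0) (hz : z ≠ 0) :
    Summable fun a : ℤ => ‖q ^ tri a * z ^ a‖ := by
  have hz' : 0 < ‖z‖ := norm_pos_iff.mpr hz
  have hq' : 0 < ‖q‖ := norm_pos_iff.mpr hq0
  apply Summable.of_nat_of_neg
  · refine (summable_pow_choose_two_mul_pow (norm_nonneg q) hq hz').congr fun n => ?_
    rw [tri_natCast, zpow_natCast, zpow_natCast, norm_mul, norm_pow, norm_pow]
  · refine (summable_pow_choose_two_mul_pow (norm_nonneg q) hq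
      (s := ‖q‖ * ‖z‖⁻¹) (by positivity)).congr fun n => ?_
    rw [tri_neg, tri_natCast, ← Nat.cast_add, zpow_natCast, zpow_neg, zpow_natCast, norm_mul,
      norm_pow, norm_inv, norm_pow, pow_add, mul_pow, inv_pow]
    ring

/-- Jacobi's triple product identity. -/
theorem hasSum_jacobi {q z : ℂ} (hq : ‖q‖ < 1) (hq0 : q ≠ 0) (hz : z ≠ 0) :
    HasSum (fun a : ℤ => q ^ tri a * z ^ a)
      (eulerPhi q * (∏' j : ℕ, (1 + z * q ^ j)) * ∏' j : ℕ, (1 + z⁻¹ * q ^ (j + 1))) := by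
  have hφ := eulerPhi_ne_zero hq
  obtain ⟨C, hC⟩ := exists_norm_qBinom_le hq
  have hs := summable_norm_theta hq hq0 hz
  -- The finite triple product, recentred at `r = n + k` and extended by zero to all `k`. The guard
  -- is needed because `toNat` sends negative integers to `0`, where the `q`-binomial is `1`; for `k
  -- > n` the `q`-binomial itself vanishes.
  let f : ℕ → ℤ → ℂ := fun n k =>
    if 0 ≤ (n : ℤ) + k then qBinom q (2 * n) ((n : ℤ) + k).toNat * (q ^ tri k * z ^ k) else 0
  have hlim : Tendsto (fun n => ∑' k, f n k) atTop
      (𝓝 (∑' k : ℤ, (eulerPhi q)⁻¹ * (q ^ tri k * z ^ k))) := by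
    refine tendsto_tsum_of_dominated_convergence (hs.mul_left C) (fun k => ?_)
      (Eventually.of_forall fun n k => ?_)
    · refine ((tendsto_qBinom hq k).mul_const _).congr' ?_
      filter_upwards [eventually_ge_atTop k.natAbs] with n hn
      simp only [f]
      rw [if_pos (by omega)]
    · simp only [f]
      split_ifs
      · rw [norm_mul]
        exact mul_le_mul_of_nonneg_right (hC _ _) (norm_nonneg _)
      · rw [norm_zero]
        exact mul_nonneg ((norm_nonneg _).trans (hC 0 0)) (norm_nonneg _)
  have hfin : ∀ n, ∑' k, f n k =
      (∏ i ∈ range n, (1 + z * q ^ i)) * ∏ i ∈ range n, (1 + z⁻¹ * q ^ (i + 1)) := by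
    intro n
    have hinj : Function.Injective fun r : ℕ => (r : ℤ) - n := fun a b h => by
      simpa using h
    rw [prod_mul_prod_eq_sum hq hq0 hz, tsum_eq_sum (s := (range (2 * n + 1)).map ⟨_, hinj⟩),
      sum_map]
    · refine sum_congr rfl fun r _ => ?_
      simp [f]
    · intro k hk
      simp only [f]
      split_ifs with h
      · rw [qBinom_of_lt, zero_mul]
        by_contra hlt
        refine hk (mem_map.mpr ⟨((n : ℤ) + k).toNat, by simp; omega, ?_⟩)
        simp [h]
      · rfl
  have hm1 : Multipliable fun j : ℕ => 1 + z * q ^ j := by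
    simpa using multipliable_one_add_mul_pow hq 0 z
  have hprod : Tendsto (fun n => ∑' k, f n k) atTop
      (𝓝 ((∏' j : ℕ, (1 + z * q ^ j)) * ∏' j : ℕ, (1 + z⁻¹ * q ^ (j + 1)))) := by
    simp_rw [hfin]
    exact hm1.hasProd.tendsto_prod_nat.mul
      (multipliable_one_add_mul_pow hq 1 z⁻¹).hasProd.tendsto_prod_nat
  have heq := tendsto_nhds_unique hlim hprod
  rw [tsum_mul_left] at heq
  rw [mul_assoc, ← heq, mul_inv_cancel_left₀ hφ]
  exact hs.of_norm.hasSum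

/-! ### Dissection of infinite products -/

theorem norm_pow_lt_one {q : ℂ} (hq : ‖q‖ < 1) {n : ℕ} (hn : 0 < n) : ‖q ^ n‖ < 1 := by
  rw [norm_pow]
  exact pow_lt_one₀ (norm_nonneg q) hq hn.ne'

theorem prod_range_mul_eq {M : Type*} [CommMonoid M] (f : ℕ → M) (N n : ℕ) :
    ∏ k ∈ range (N * n), f k = ∏ i ∈ range N, ∏ j ∈ range n, f (N * j + i) := by
  induction n with
  | zero => simp
  | succ n ih =>
    rw [Nat.mul_succ, prod_range_add, ih, ← prod_mul_distrib]
    simp_rw [prod_range_succ]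

theorem tprod_eq_prod_tprod {f : ℕ → ℂ} {N : ℕ} (hN : 0 < N) (hf : Multipliable f)
    (hf' : ∀ i < N, Multipliable fun j => f (N * j + i)) :
    ∏' n, f n = ∏ i ∈ range N, ∏' j, f (N * j + i) := by
  have h1 : Tendsto (fun n => ∏ k ∈ range (N * n), f k) atTop (𝓝 (∏' n, f n)) :=
    hf.hasProd.tendsto_prod_nat.comp
      (tendsto_atTop_atTop.mpr fun b => ⟨b, fun a ha => by nlinarith⟩)
  have h2 : Tendsto (fun n => ∏ i ∈ range N, ∏ j ∈ range n, f (N * j + i)) atTop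
      (𝓝 (∏ i ∈ range N, ∏' j, f (N * j + i))) :=
    tendsto_finsetProd _ fun i hi => (hf' i (mem_range.mp hi)).hasProd.tendsto_prod_nat
  simp_rw [prod_range_mul_eq] at h1
  exact tendsto_nhds_unique h1 h2

theorem multipliable_one_add_mul_pow_linear {q : ℂ} (hq : ‖q‖ < 1) {c : ℕ} (hc : 0 < c) (d : ℕ)
    (w : ℂ) : Multipliable fun j : ℕ => 1 + w * q ^ (c * j + d) :=
  multipliable_one_add_of_summable (summable_norm_pow hq hc d w)

theorem tprod_one_add_mul_pow_dissection {q : ℂ} (hq : ‖q‖ < 1) {N c : ℕ} (hN : 0 < N)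
    (hc : 0 < c) (d : ℕ) (w : ℂ) :
    ∏' n : ℕ, (1 + w * q ^ (c * n + d)) =
      ∏ i ∈ range N, ∏' j : ℕ, (1 + w * q ^ (c * (N * j + i) + d)) := by
  refine tprod_eq_prod_tprod hN (multipliable_one_add_mul_pow_linear hq hc d w) fun i _ => ?_
  refine (multipliable_one_add_mul_pow_linear hq (Nat.mul_pos hc hN) (c * i + d) w).congr
    fun j => ?_
  rw [show c * N * j + (c * i + d) = c * (N * j + i) + d by ring]

/-- The product side of Jacobi's triple product identity. -/
noncomputable def jacobiProd (q z : ℂ) : ℂ :=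
  eulerPhi q * (∏' j : ℕ, (1 + z * q ^ j)) * ∏' j : ℕ, (1 + z⁻¹ * q ^ (j + 1))

/-- The shifts `z q^d` with `0 ≤ d < N` run through all residue classes mod `N`, so the factors of
base `q^N` interleave into those of base `q`; only the Euler factors have to be corrected. -/
theorem prod_jacobiProd {q z : ℂ} (hq : ‖q‖ < 1) (hq0 : q ≠ 0) {N : ℕ} (hN : 0 < N) :
    ∏ d ∈ range N, jacobiProd (q ^ N) (z * q ^ d) =
      eulerPhi (q ^ N) ^ N * (eulerPhi q)⁻¹ * jacobiProd q z := by
  have h1 := tprod_one_add_mul_pow_dissection hq hN one_pos 0 z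
  have h2 := tprod_one_add_mul_pow_dissection hq hN one_pos 1 z⁻¹
  simp only [one_mul, add_zero] at h1 h2
  have h3 : ∏ d ∈ range N, ∏' j : ℕ, (1 + z * q ^ d * (q ^ N) ^ j) =
      ∏ i ∈ range N, ∏' j : ℕ, (1 + z * q ^ (N * j + i)) := by
    refine prod_congr rfl fun i _ => tprod_congr fun j => ?_
    rw [pow_add, pow_mul]
    ring
  have h4 : ∏ d ∈ range N, ∏' j : ℕ, (1 + (z * q ^ d)⁻¹ * (q ^ N) ^ (j + 1)) =
      ∏ i ∈ range N, ∏' j : ℕ, (1 + z⁻¹ * q ^ (N * j + i + 1)) := by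
    -- The inverse factors carry the exponent `N (j + 1) - d`, so the shift `d` corresponds to the
    -- class `i = N - 1 - d`.
    rw [← prod_range_reflect]
    refine prod_congr rfl fun i hi => tprod_congr fun j => ?_
    have hi' : i < N := mem_range.mp hi
    rw [← pow_mul, show N * (j + 1) = (N * j + i + 1) + (N - 1 - i) by
      rw [Nat.mul_succ]; omega, pow_add, mul_inv]
    field_simp
  simp only [jacobiProd]
  rw [prod_mul_distrib, prod_mul_distrib, h3, h4, ← h1, ← h2, prod_const, card_range]
  field_simp [eulerPhi_ne_zero hq]

theorem eulerPhi_sq {q : ℂ} (hq : ‖q‖ < 1) :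
    eulerPhi (q ^ 2) = eulerPhi q * ∏' j : ℕ, (1 + q ^ (j + 1)) := by
  have h := multipliable_one_add_mul_pow hq 1 1
  simp only [one_mul] at h
  rw [eulerPhi, eulerPhi, ← (multipliable_one_sub_pow hq).tprod_mul h]
  refine tprod_congr fun j => ?_
  ring

/-- Gauss's evaluation of the generating function of the triangular numbers. -/
theorem jacobiProd_four {q : ℂ} (hq : ‖q‖ < 1) (hq0 : q ≠ 0) :
    jacobiProd (q ^ 4) q = eulerPhi (q ^ 2) ^ 2 * (eulerPhi q)⁻¹ := by
  have hφ := eulerPhi_ne_zero hq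
  -- The exponents `4j + 1` and `4j + 3` give all odd numbers. Writing `φ(q⁴) = φ(q²) ∏ (1 +
  -- q^{2j})` supplies the even ones, and the full product `∏ (1 + q^j)` is `φ(q²) / φ(q)`.
  have hodd := tprod_one_add_mul_pow_dissection (N := 2) (c := 2) hq two_pos two_pos 1 1
  have hall := tprod_one_add_mul_pow_dissection (N := 2) (c := 1) hq two_pos one_pos 1 1
  rw [prod_range_succ, prod_range_one] at hodd hall
  simp only [one_mul, add_zero] at hodd hall
  have h2 := eulerPhi_sq hq
  have h4 := eulerPhi_sq (norm_pow_lt_one (n := 2) hq two_pos)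
  rw [← pow_mul] at h4
  norm_num at h4
  have e1 : ∏' j : ℕ, (1 + q * (q ^ 4) ^ j) = ∏' j : ℕ, (1 + q ^ (2 * (2 * j) + 1)) :=
    tprod_congr fun j => by rw [← pow_mul]; ring
  have e2 : ∏' j : ℕ, (1 + q⁻¹ * (q ^ 4) ^ (j + 1)) =
      ∏' j : ℕ, (1 + q ^ (2 * (2 * j + 1) + 1)) :=
    tprod_congr fun j => by
      rw [← pow_mul, show 4 * (j + 1) = 2 * (2 * j + 1) + 1 + 1 by ring, pow_succ q (_ + 1)]
      field_simp
  have e3 : ∏' j : ℕ, (1 + (q ^ 2) ^ (j + 1)) = ∏' j : ℕ, (1 + q ^ (2 * j + 1 + 1)) :=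
    tprod_congr fun j => by rw [← pow_mul]; ring
  rw [jacobiProd, mul_assoc, e1, e2, ← hodd, eq_mul_inv_iff_mul_eq₀ hφ, h4, e3]
  calc _ = eulerPhi (q ^ 2) * (eulerPhi q * ((∏' j : ℕ, (1 + q ^ (2 * j + 1))) *
      ∏' j : ℕ, (1 + q ^ (2 * j + 1 + 1)))) := by ring
    _ = _ := by rw [← hall, ← h2, sq (eulerPhi _)]

/-! ### Products of series and constant terms -/

theorem summable_norm_prod_and_hasSum {ι : Type*} {n : ℕ} (f : Fin n → ι → ℂ)
    (hf : ∀ i, Summable fun a => ‖f i a‖) :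
    (Summable fun x : Fin n → ι => ‖∏ i, f i (x i)‖) ∧
      HasSum (fun x : Fin n → ι => ∏ i, f i (x i)) (∏ i, ∑' a, f i a) := by
  induction n with
  | zero =>
    refine ⟨(hasSum_fintype _).summable, ?_⟩
    simp
  | succ n ih =>
    obtain ⟨h1, h2⟩ := ih (fun i => f i.succ) fun i => hf i.succ
    have hnorm := Summable.mul_norm (hf 0) h1
    refine ⟨?_, ?_⟩
    · rw [← (Fin.consEquiv fun _ => ι).summable_iff]
      refine hnorm.congr fun p => ?_
      simp [Fin.consEquiv, Fin.prod_univ_succ]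
    · rw [← (Fin.consEquiv fun _ => ι).hasSum_iff, Fin.prod_univ_succ]
      refine ((hf 0).of_norm.hasSum.mul h2 hnorm.of_norm).congr_fun fun p => ?_
      simp [Fin.consEquiv, Fin.prod_univ_succ]

theorem integral_exp_zpow (n : ℤ) :
    ∫ t in (0 : ℝ)..2 * Real.pi, Complex.exp (t * Complex.I) ^ n =
      if n = 0 then ((2 * Real.pi : ℝ) : ℂ) else 0 := by
  simp_rw [← Complex.exp_int_mul]
  split_ifs with h
  · subst h
    simp
  · have hc : (n : ℂ) * Complex.I ≠ 0 := mul_ne_zero (by exact_mod_cast h) Complex.I_ne_zero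
    have := integral_exp_mul_complex (a := 0) (b := 2 * Real.pi) hc
    simp_rw [show ∀ t : ℝ, (n : ℂ) * (t * Complex.I) = n * Complex.I * t from fun t => by ring]
    rw [this]
    have h1 : (n : ℂ) * Complex.I * ((2 * Real.pi : ℝ) : ℂ) = n * (2 * Real.pi * Complex.I) := by
      push_cast; ring
    rw [h1, Complex.exp_int_mul_two_pi_mul_I]
    simp

/-- The constant term of an absolutely convergent Laurent series on the unit circle. -/
theorem hasSum_integral_circle {ι : Type*} [Countable ι] {g : ι → ℂ} (w : ι → ℤ)
    (hg : Summable fun i => ‖g i‖) :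
    HasSum (fun i => ((2 * Real.pi : ℝ) : ℂ) * if w i = 0 then g i else 0)
      (∫ t in (0 : ℝ)..2 * Real.pi, ∑' i, g i * Complex.exp (t * Complex.I) ^ w i) := by
  have hnorm : ∀ i (t : ℝ), ‖g i * Complex.exp (t * Complex.I) ^ w i‖ = ‖g i‖ := fun i t => by
    rw [norm_mul, norm_zpow, Complex.norm_exp_ofReal_mul_I, one_zpow, mul_one]
  have hcont : ∀ i, Continuous fun t : ℝ => g i * Complex.exp (t * Complex.I) ^ w i := fun i => by
    simp_rw [← Complex.exp_int_mul]
    fun_prop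
  have h := intervalIntegral.hasSum_integral_of_dominated_convergence
    (μ := volume) (a := 0) (b := 2 * Real.pi)
    (F := fun i (t : ℝ) => g i * Complex.exp (t * Complex.I) ^ w i)
    (f := fun t : ℝ => ∑' i, g i * Complex.exp (t * Complex.I) ^ w i)
    (fun i _ => ‖g i‖) (fun i => (hcont i).aestronglyMeasurable)
    (fun i => Eventually.of_forall fun t _ => (hnorm i t).le)
    (Eventually.of_forall fun t _ => hg) (by simp)
    (Eventually.of_forall fun t _ => Summable.hasSum (.of_norm (by simpa only [hnorm] using hg)))
  refine h.congr_fun fun i => ?_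
  rw [intervalIntegral.integral_const_mul, integral_exp_zpow]
  split_ifs <;> ring

/-- Two absolutely convergent Laurent series that agree on the unit circle have the same
constant term. -/
theorem hasSum_constantTerm {ι κ : Type*} [Countable ι] [Countable κ] {g : ι → ℂ} {h : κ → ℂ}
    (w : ι → ℤ) (v : κ → ℤ) (hg : Summable fun i => ‖g i‖) (hh : Summable fun i => ‖h i‖)
    (heq : ∀ z : ℂ, ‖z‖ = 1 → ∑' i, g i * z ^ w i = ∑' j, h j * z ^ v j) {S : ℂ}
    (hS : HasSum (fun j => if v j = 0 then h j else 0) S) :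
    HasSum (fun i => if w i = 0 then g i else 0) S := by
  have hpi : ((2 * Real.pi : ℝ) : ℂ) ≠ 0 := by
    exact_mod_cast (by positivity : (2 * Real.pi : ℝ) ≠ 0)
  have h1 := hasSum_integral_circle w hg
  have h2 := hasSum_integral_circle v hh
  simp_rw [heq _ (Complex.norm_exp_ofReal_mul_I _)] at h1
  rw [h2.unique (hS.mul_left _)] at h1
  exact (hasSum_mul_left_iff hpi).mp h1

/-! ### The root lattice in Euclidean coordinates -/

/-- The coordinates `k_{j+1} - k_j` (with `k_0 = k_{n+1} = 0`) of the element of the root lattice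
`A_n` with coefficients `k` in the basis of simple roots. -/
def rootCoord {n : ℕ} (k : Fin n → ℤ) (j : Fin (n + 1)) : ℤ :=
  Fin.snoc (α := fun _ => ℤ) k 0 j - Fin.cons (α := fun _ => ℤ) 0 k j

/-- Summation by parts; the boundary terms vanish since `k_0 = k_{n+1} = 0`. -/
theorem sum_mul_rootCoord {n : ℕ} (d : ℕ → ℤ) (k : Fin n → ℤ) :
    ∑ j : Fin (n + 1), d j * rootCoord k j = ∑ i : Fin n, (d i - d (i + 1)) * k i := by
  simp only [rootCoord, mul_sub, sub_mul, sum_sub_distrib]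
  rw [Fin.sum_univ_castSucc, Fin.sum_univ_succ (fun j : Fin (n + 1) => d j * Fin.cons (α := fun _ => ℤ) 0 k j)]
  simp

theorem sum_rootCoord {n : ℕ} (k : Fin n → ℤ) : ∑ j, rootCoord k j = 0 := by
  simpa using sum_mul_rootCoord (fun _ => 1) k

/-- Expanding squares gives `∑ x_j² = 2κ`, and the linear part of `tri` drops out because `∑ x_j =
0`. -/
theorem sum_tri_rootCoord {n : ℕ} (hn : 0 < n) (k : Fin n → ℤ) :
    ∑ j, tri (rootCoord k j) = kappa k := by
  obtain ⟨n, rfl⟩ := Nat.exists_eq_succ_of_ne_zero hn.ne'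
  have hsnoc : ∑ j, Fin.snoc (α := fun _ => ℤ) k 0 j ^ 2 = ∑ i, k i ^ 2 := by
    rw [Fin.sum_univ_castSucc]; simp
  have hcons : ∑ j, Fin.cons (α := fun _ => ℤ) 0 k j ^ 2 = ∑ i, k i ^ 2 := by
    rw [Fin.sum_univ_succ]; simp
  have hmix : ∑ j, Fin.snoc (α := fun _ => ℤ) k 0 j * Fin.cons (α := fun _ => ℤ) 0 k j =
      ∑ i : Fin n, k i.castSucc * k i.succ := by
    rw [Fin.sum_univ_succ, Fin.sum_univ_castSucc]
    simp only [Fin.cons_zero, mul_zero, zero_add, Fin.succ_last, Fin.snoc_last,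
      zero_mul, add_zero, Fin.succ_castSucc, Fin.snoc_castSucc]
    exact sum_congr rfl fun i _ => mul_comm _ _
  have hsq : ∑ j, rootCoord k j ^ 2 = 2 * kappa k := by
    have : ∀ j, rootCoord k j ^ 2 = Fin.snoc (α := fun _ => ℤ) k 0 j ^ 2 +
        Fin.cons (α := fun _ => ℤ) 0 k j ^ 2 -
        2 * (Fin.snoc (α := fun _ => ℤ) k 0 j * Fin.cons (α := fun _ => ℤ) 0 k j) := fun j => by
      rw [rootCoord]; ring
    simp_rw [this]
    rw [sum_sub_distrib, sum_add_distrib, hsnoc, hcons, ← mul_sum, hmix]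
    have : kappa k = ∑ i, k i ^ 2 - ∑ i : Fin n, k i.castSucc * k i.succ := rfl
    rw [this]
    ring
  have h2 : 2 * ∑ j, tri (rootCoord k j) = 2 * kappa k := by
    rw [← hsq, mul_sum]
    simp_rw [two_mul_tri, mul_sub, mul_one]
    rw [sum_sub_distrib, sum_rootCoord, sub_zero]
    exact sum_congr rfl fun j _ => (sq _).symm
  linarith

theorem rootCoord_injective (n : ℕ) : Function.Injective (rootCoord (n := n)) := by
  intro k l h
  suffices ∀ N : ℕ, ∀ i : Fin n, (i : ℕ) = N → k i = l i from funext fun i => this i i rfl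
  intro N
  induction N with
  | zero =>
    intro i hi
    have hi' : i.castSucc = 0 := Fin.ext hi
    have := congrFun h i.castSucc
    rw [rootCoord, rootCoord, Fin.snoc_castSucc, Fin.snoc_castSucc, hi'] at this
    simpa using this
  | succ N ih =>
    intro i hi
    have hi' : i.castSucc = (⟨N, by omega⟩ : Fin n).succ := Fin.ext hi
    have := congrFun h i.castSucc
    rw [rootCoord, rootCoord, Fin.snoc_castSucc, Fin.snoc_castSucc, hi', Fin.cons_succ,
      Fin.cons_succ, ih ⟨N, by omega⟩ rfl] at this
    simpa using this

theorem range_rootCoord (n : ℕ) :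
    Set.range (rootCoord (n := n)) = {x | ∑ j, x j = 0} := by
  refine Set.Subset.antisymm (Set.range_subset_iff.mpr sum_rootCoord) fun x hx => ?_
  let X : ℕ → ℤ := fun i => if h : i < n + 1 then x ⟨i, h⟩ else 0
  have hX : ∀ j : Fin (n + 1), X j = x j := fun j => dif_pos j.isLt
  have htot : ∑ i ∈ range (n + 1), X i = 0 := by
    rw [← Fin.sum_univ_eq_sum_range]
    simpa [hX] using hx
  -- The preimage consists of partial sums; the vanishing total gives the boundary value `k_{n+1} =
  -- 0`.
  refine ⟨fun i => ∑ j ∈ range (i + 1), X j, funext fun j => ?_⟩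
  have h1 : Fin.snoc (α := fun _ => ℤ) (fun i : Fin n => ∑ j ∈ range (i + 1), X j) 0 j =
      ∑ i ∈ range (j + 1), X i := by
    refine Fin.lastCases ?_ (fun i => ?_) j
    · rw [Fin.snoc_last, Fin.val_last, htot]
    · rw [Fin.snoc_castSucc, Fin.val_castSucc]
  have h2 : Fin.cons (α := fun _ => ℤ) 0 (fun i : Fin n => ∑ j ∈ range (i + 1), X j) j =
      ∑ i ∈ range j, X i := by
    refine Fin.cases ?_ (fun i => ?_) j
    · simp
    · rw [Fin.cons_succ, Fin.val_succ]
  rw [rootCoord, h1, h2, sum_range_succ, add_sub_cancel_left, hX]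

/-- The linear weights in Euclidean coordinates: `2, 5, …, 3m - 1` followed by
`1, 2, …, 3m - 1, 0`. -/
def weight (m j : ℕ) : ℕ :=
  if j < m then 2 + 3 * j else if j < 4 * m - 1 then j - m + 1 else 0

theorem weight_lt {m : ℕ} (hm : 0 < m) {j : ℕ} : weight m j < 3 * m := by
  unfold weight
  split_ifs <;> omega

/-- The weights rise by `3` and then by `1`; the two exceptional coefficients are the drops from `3m
- 1` to `1` and from `3m - 1` to `0`. -/
theorem linTildeCoeff_eq {m : ℕ} (hm : 0 < m) {j : ℕ} (hj : j < 4 * m - 1) :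
    linTildeCoeff m (j + 1) = (weight m j : ℤ) - weight m (j + 1) := by
  unfold linTildeCoeff weight
  split_ifs <;> omega

theorem secondExponent_eq {m : ℕ} (hm : 0 < m) (k : Fin (4 * m - 1) → ℤ) :
    secondExponent m k =
      ∑ j, (3 * (m : ℤ) * tri (rootCoord k j) + weight m j * rootCoord k j) := by
  rw [sum_add_distrib, ← mul_sum, sum_tri_rootCoord (by omega),
    sum_mul_rootCoord (fun j => (weight m j : ℤ)), secondExponent, linTilde]
  congr 1
  exact sum_congr rfl fun i _ => by rw [linTildeCoeff_eq hm i.isLt]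

/-- Only `x < 0` needs an argument: there `tri x ≥ |x|`, so the quadratic term is at least `M |x| ≥
d |x|`. -/
theorem mul_tri_add_mul_nonneg {M d : ℤ} (hd : 0 ≤ d) (hdM : d < M) (x : ℤ) :
    0 ≤ M * tri x + d * x := by
  have h := two_mul_tri x
  rcases le_or_gt 0 x with hx | hx
  · exact add_nonneg (mul_nonneg (by omega) (tri_nonneg x)) (mul_nonneg hd hx)
  · have h1 : -x ≤ tri x := by nlinarith
    nlinarith

theorem secondExponent_nonneg {m : ℕ} (hm : 0 < m) (k : Fin (4 * m - 1) → ℤ) :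
    0 ≤ secondExponent m k := by
  rw [secondExponent_eq hm]
  exact sum_nonneg fun j _ => mul_tri_add_mul_nonneg (by positivity)
    (by exact_mod_cast weight_lt hm) _

/-! ### The identity on the punctured disc -/

theorem prod_range_weight {m : ℕ} (hm : 0 < m) (f : ℕ → ℂ) :
    ∏ j ∈ range (4 * m - 1 + 1), f (weight m j) =
      (∏ i ∈ range m, f (2 + 3 * i)) * ∏ i ∈ range (3 * m), f i := by
  obtain ⟨n, rfl⟩ := Nat.exists_eq_succ_of_ne_zero hm.ne'
  rw [show 4 * n.succ - 1 + 1 = n.succ + 3 * n.succ by omega, prod_range_add]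
  congr 1
  · refine prod_congr rfl fun i hi => ?_
    rw [weight, if_pos (mem_range.mp hi)]
  · rw [show 3 * n.succ = 3 * n + 2 + 1 by omega, prod_range_succ, prod_range_succ' f]
    congr 1
    · refine prod_congr rfl fun i hi => ?_
      have := mem_range.mp hi
      rw [weight, if_neg (by omega), if_pos (by omega)]
      congr 1
      omega
    · rw [weight, if_neg (by omega), if_neg (by omega)]

/-- Two uses of `prod_jacobiProd`: the weights `0, …, 3m-1` with base `q` and `N = 3m`, and the
weights `2 + 3i` with base `q³`, `N = m` and `z q²` in place of `z`. -/
theorem prod_jacobiProd_weight {q z : ℂ} (hq : ‖q‖ < 1) (hq0 : q ≠ 0) {m : ℕ} (hm : 0 < m) :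
    ∏ j : Fin (4 * m - 1 + 1), jacobiProd (q ^ (3 * m)) (z * q ^ weight m j) =
      eulerPhi (q ^ (3 * m)) ^ (4 * m) * (eulerPhi q * eulerPhi (q ^ 3))⁻¹ *
        (jacobiProd q z * jacobiProd (q ^ 3) (z * q ^ 2)) := by
  have h3 := prod_jacobiProd (z := z * q ^ 2) (norm_pow_lt_one (n := 3) hq (by norm_num))
    (pow_ne_zero 3 hq0) hm
  have h1 := prod_jacobiProd (z := z) (N := 3 * m) hq hq0 (by omega)
  rw [Fin.prod_univ_eq_prod_range (fun j => jacobiProd (q ^ (3 * m)) (z * q ^ weight m j)),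
    prod_range_weight hm (fun d => jacobiProd (q ^ (3 * m)) (z * q ^ d)), h1]
  simp_rw [← pow_mul, mul_assoc, ← pow_add] at h3
  rw [h3, show 4 * m = m + 3 * m by ring, pow_add, mul_inv]
  ring

theorem zpow_sum₀ {ι : Type*} {z : ℂ} (hz : z ≠ 0) (s : Finset ι) (e : ι → ℤ) :
    z ^ (∑ j ∈ s, e j) = ∏ j ∈ s, z ^ e j := by
  classical
  induction s using Finset.induction_on with
  | empty => simp
  | insert a s ha ih => rw [sum_insert ha, prod_insert ha, zpow_add₀ hz, ih]

theorem summable_norm_prod_theta {Q q : ℂ} (hQ : ‖Q‖ < 1) (hQ0 : Q ≠ 0) (hq0 : q ≠ 0) {n : ℕ}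
    (d : Fin n → ℕ) :
    Summable fun x : Fin n → ℤ => ‖∏ j, (Q ^ tri (x j) * (q ^ d j) ^ x j)‖ :=
  (summable_norm_prod_and_hasSum (fun j a => Q ^ tri a * (q ^ d j) ^ a) fun j =>
    summable_norm_theta hQ hQ0 (pow_ne_zero (d j) hq0)).1

theorem hasSum_prod_theta {Q q z : ℂ} (hQ : ‖Q‖ < 1) (hQ0 : Q ≠ 0) (hq0 : q ≠ 0) (hz : z ≠ 0)
    {n : ℕ} (d : Fin n → ℕ) :
    HasSum (fun x : Fin n → ℤ => (∏ j, (Q ^ tri (x j) * (q ^ d j) ^ x j)) * z ^ ∑ j, x j)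
      (∏ j, jacobiProd Q (z * q ^ d j)) := by
  have h := (summable_norm_prod_and_hasSum (fun j a => Q ^ tri a * (z * q ^ d j) ^ a) fun j =>
    summable_norm_theta hQ hQ0 (mul_ne_zero hz (pow_ne_zero (d j) hq0))).2
  have hval : ∀ j, ∑' a, Q ^ tri a * (z * q ^ d j) ^ a = jacobiProd Q (z * q ^ d j) := fun j =>
    (hasSum_jacobi hQ hQ0 (mul_ne_zero hz (pow_ne_zero _ hq0))).tsum_eq
  simp_rw [hval] at h
  refine h.congr_fun fun x => ?_
  rw [zpow_sum₀ hz, ← prod_mul_distrib]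
  refine prod_congr rfl fun j _ => ?_
  rw [mul_zpow]
  ring

theorem summable_norm_theta_mul_theta {q z : ℂ} (hq : ‖q‖ < 1) (hq0 : q ≠ 0) (hz : z ≠ 0) :
    Summable fun p : ℤ × ℤ =>
      ‖q ^ tri p.1 * z ^ p.1 * ((q ^ 3) ^ tri p.2 * (z * q ^ 2) ^ p.2)‖ :=
  Summable.mul_norm (f := fun a : ℤ => q ^ tri a * z ^ a)
    (g := fun b : ℤ => (q ^ 3) ^ tri b * (z * q ^ 2) ^ b) (summable_norm_theta hq hq0 hz)
    (summable_norm_theta (norm_pow_lt_one (n := 3) hq (by norm_num)) (pow_ne_zero 3 hq0)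
      (mul_ne_zero hz (pow_ne_zero 2 hq0)))

theorem hasSum_theta_mul_theta {q z : ℂ} (hq : ‖q‖ < 1) (hq0 : q ≠ 0) (hz : z ≠ 0) (C : ℂ) :
    HasSum (fun p : ℤ × ℤ =>
        C * (q ^ tri p.1 * ((q ^ 3) ^ tri p.2 * (q ^ 2) ^ p.2)) * z ^ (p.1 + p.2))
      (C * (jacobiProd q z * jacobiProd (q ^ 3) (z * q ^ 2))) := by
  refine (((hasSum_jacobi hq hq0 hz).mul (hasSum_jacobi (norm_pow_lt_one (n := 3) hq (by norm_num))
    (pow_ne_zero _ hq0) (mul_ne_zero hz (pow_ne_zero 2 hq0)))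
    (summable_norm_theta_mul_theta hq hq0 hz).of_norm).mul_left C).congr_fun fun p => ?_
  rw [zpow_add₀ hz, mul_zpow]
  ring

/-- The constant term of a product of two theta series is Gauss's series. -/
theorem hasSum_constantTerm_theta {q : ℂ} (hq : ‖q‖ < 1) (hq0 : q ≠ 0) (C : ℂ) :
    HasSum (fun p : ℤ × ℤ => if p.1 + p.2 = 0 then
        C * (q ^ tri p.1 * ((q ^ 3) ^ tri p.2 * (q ^ 2) ^ p.2)) else 0)
      (C * (eulerPhi (q ^ 2) ^ 2 * (eulerPhi q)⁻¹)) := by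
  -- On the antidiagonal `(a, -a)` the exponent is `tri a + 3 tri (-a) - 2a = 4 tri a + a`, that of
  -- the theta series of base `q⁴` at `z = q`.
  have hinj : Function.Injective fun a : ℤ => (a, -a) := fun a b hab => (Prod.ext_iff.mp hab).1
  rw [← hinj.hasSum_iff, ← jacobiProd_four hq hq0]
  · refine ((hasSum_jacobi (z := q) (norm_pow_lt_one (n := 4) hq (by norm_num))
      (pow_ne_zero 4 hq0) hq0).mul_left C).congr_fun fun a => ?_
    simp only [Function.comp, add_neg_cancel, if_true]
    have h4 : (q ^ 4) ^ tri a * q ^ a = q ^ (4 * tri a + a) := by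
      rw [zpow_add₀ hq0, zpow_mul]; norm_cast
    have h3 : q ^ tri a * ((q ^ 3) ^ tri (-a) * (q ^ 2) ^ (-a)) =
        q ^ (tri a + (3 * tri (-a) + 2 * (-a))) := by
      rw [zpow_add₀ hq0, zpow_add₀ hq0, zpow_mul, zpow_mul]; norm_cast
    rw [h4, h3, tri_neg]
    congr 2
    ring
  · rintro ⟨a, b⟩ hab
    refine if_neg fun h0 => hab ⟨a, ?_⟩
    have h1 : a + b = 0 := h0
    exact Prod.ext rfl (by simp; omega)

theorem zpow_secondExponent {q : ℂ} (hq0 : q ≠ 0) {m : ℕ} (hm : 0 < m)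
    (k : Fin (4 * m - 1) → ℤ) :
    q ^ secondExponent m k = ∏ j : Fin (4 * m - 1 + 1),
      ((q ^ (3 * m)) ^ tri (rootCoord k j) * (q ^ weight m j) ^ rootCoord k j) := by
  rw [secondExponent_eq hm, zpow_sum₀ hq0]
  refine prod_congr rfl fun j _ => ?_
  rw [show 3 * (m : ℤ) = ((3 * m : ℕ) : ℤ) by push_cast; rfl, zpow_add₀ hq0, zpow_mul, zpow_mul,
    zpow_natCast, zpow_natCast]

theorem hasSum_secondExponent {q : ℂ} (hq : ‖q‖ < 1) (hq0 : q ≠ 0) {m : ℕ} (hm : 0 < m) :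
    HasSum (fun k : Fin (4 * m - 1) → ℤ => q ^ secondExponent m k) (secondProduct m q) := by
  have hQ : ‖q ^ (3 * m)‖ < 1 := norm_pow_lt_one hq (by omega)
  have hQ0 : q ^ (3 * m) ≠ 0 := pow_ne_zero _ hq0
  set C : ℂ := eulerPhi (q ^ (3 * m)) ^ (4 * m) * (eulerPhi q * eulerPhi (q ^ 3))⁻¹ with hC
  have hval : C * (eulerPhi (q ^ 2) ^ 2 * (eulerPhi q)⁻¹) = secondProduct m q := by
    rw [hC, secondProduct, mul_inv, mul_inv, sq (eulerPhi q), mul_inv]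
    ring
  have hT := hasSum_constantTerm (fun x : Fin (4 * m - 1 + 1) → ℤ => ∑ j, x j)
    (fun p : ℤ × ℤ => p.1 + p.2)
    (summable_norm_prod_theta hQ hQ0 hq0 fun j => weight m j)
    (h := fun p : ℤ × ℤ => C * (q ^ tri p.1 * ((q ^ 3) ^ tri p.2 * (q ^ 2) ^ p.2))) ?_
    (fun z hz1 => ?_) (hasSum_constantTerm_theta hq hq0 C)
  -- The constant term retains the `x` with `∑ x_j = 0`, which `rootCoord` parametrises bijectively.
  · rw [← (rootCoord_injective _).hasSum_iff, hval] at hT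
    · refine hT.congr_fun fun k => ?_
      rw [zpow_secondExponent hq0 hm, Function.comp, if_pos (sum_rootCoord k)]
    · intro x hx
      rw [range_rootCoord] at hx
      exact if_neg hx
  · refine ((summable_norm_theta_mul_theta hq hq0 one_ne_zero).mul_left ‖C‖).congr fun p => ?_
    rw [norm_mul C, one_zpow, mul_one, one_mul]
  · have hz : z ≠ 0 := norm_pos_iff.mp (by rw [hz1]; exact one_pos)
    rw [(hasSum_prod_theta hQ hQ0 hq0 hz _).tsum_eq, (hasSum_theta_mul_theta hq hq0 hz C).tsum_eq,
      prod_jacobiProd_weight hq hq0 hm]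

/-! ### Formal power series and their values on the unit disc -/

/-- The formal power series `F` converges absolutely to `f` on the open unit disc. -/
def ConvergesTo (F : ℂ⟦X⟧) (f : ℂ → ℂ) : Prop :=
  ∀ q : ℂ, ‖q‖ < 1 → (Summable fun n => ‖F.coeff n * q ^ n‖) ∧
    HasSum (fun n => F.coeff n * q ^ n) (f q)

theorem ConvergesTo.mul {F G : ℂ⟦X⟧} {f g : ℂ → ℂ} (hF : ConvergesTo F f)
    (hG : ConvergesTo G g) : ConvergesTo (F * G) fun q => f q * g q := by
  intro q hq
  obtain ⟨hF1, hF2⟩ := hF q hq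
  obtain ⟨hG1, hG2⟩ := hG q hq
  have hterm : ∀ n, (F * G).coeff n * q ^ n =
      ∑ p ∈ antidiagonal n, F.coeff p.1 * q ^ p.1 * (G.coeff p.2 * q ^ p.2) := by
    intro n
    rw [PowerSeries.coeff_mul, sum_mul]
    refine sum_congr rfl fun p hp => ?_
    rw [← mem_antidiagonal.mp hp, pow_add]
    ring
  have hs : Summable fun n => ‖(F * G).coeff n * q ^ n‖ := by
    simp_rw [hterm]
    exact summable_norm_sum_mul_antidiagonal_of_summable_norm
      (f := fun n => F.coeff n * q ^ n) (g := fun n => G.coeff n * q ^ n) hF1 hG1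
  refine ⟨hs, ?_⟩
  have h := tsum_mul_tsum_eq_tsum_sum_antidiagonal_of_summable_norm
    (f := fun n => F.coeff n * q ^ n) (g := fun n => G.coeff n * q ^ n) hF1 hG1
  rw [hF2.tsum_eq, hG2.tsum_eq] at h
  simp_rw [← hterm] at h
  beta_reduce
  rw [h]
  exact hs.of_norm.hasSum

theorem convergesTo_one : ConvergesTo 1 fun _ => 1 := by
  intro q _
  have h0 : ∀ n ∉ ({0} : Finset ℕ), (1 : ℂ⟦X⟧).coeff n * q ^ n = 0 := fun n hn => by
    rw [PowerSeries.coeff_one, if_neg (by simpa using hn), zero_mul]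
  have h : HasSum (fun n => (1 : ℂ⟦X⟧).coeff n * q ^ n)
      (∑ n ∈ {0}, (1 : ℂ⟦X⟧).coeff n * q ^ n) := hasSum_sum_of_ne_finset_zero h0
  rw [sum_singleton] at h
  refine ⟨summable_of_ne_finset_zero fun n hn => by rw [h0 n hn, norm_zero], by simpa using h⟩

theorem ConvergesTo.pow {F : ℂ⟦X⟧} {f : ℂ → ℂ} (hF : ConvergesTo F f) (n : ℕ) :
    ConvergesTo (F ^ n) fun q => f q ^ n := by
  induction n with
  | zero => simpa using convergesTo_one
  | succ n ih => simpa [pow_succ] using ih.mul hF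

theorem ConvergesTo.hasFPowerSeriesAt {F : ℂ⟦X⟧} {f : ℂ → ℂ} (hF : ConvergesTo F f) :
    HasFPowerSeriesAt f (FormalMultilinearSeries.ofScalars ℂ fun n => F.coeff n) 0 := by
  rw [hasFPowerSeriesAt_iff]
  filter_upwards [Metric.ball_mem_nhds (0 : ℂ) one_pos] with q hq
  have := (hF q (by simpa using hq)).2
  simpa [FormalMultilinearSeries.coeff_ofScalars, mul_comm] using this

/-- Power series that converge to the same values on the punctured unit disc are equal. -/
theorem ConvergesTo.unique {F G : ℂ⟦X⟧} {f g : ℂ → ℂ} (hF : ConvergesTo F f)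
    (hG : ConvergesTo G g) (hfg : ∀ q : ℂ, ‖q‖ < 1 → q ≠ 0 → f q = g q) : F = G := by
  have hf := hF.hasFPowerSeriesAt
  have hg := hG.hasFPowerSeriesAt
  have hev : ∀ᶠ q in 𝓝 (0 : ℂ), f q = g q := by
    refine (hf.analyticAt.frequently_eq_iff_eventually_eq hg.analyticAt).mp ?_
    refine Eventually.frequently ?_
    filter_upwards [nhdsWithin_le_nhds (Metric.ball_mem_nhds (0 : ℂ) one_pos),
      self_mem_nhdsWithin] with q hq hq0
    exact hfg q (by simpa using hq) hq0
  have heq := hf.eq_formalMultilinearSeries (hg.congr (hev.mono fun q hq => hq.symm))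
  ext n
  have := congrArg (fun p => FormalMultilinearSeries.coeff p n) heq
  simpa [FormalMultilinearSeries.coeff_ofScalars] using this

/-- A family of monomials that is absolutely summable on the unit disc is summable as a family of
formal power series, and the two sums correspond to each other. -/
theorem exists_hasSum_monomial {ι : Type*} (c : ι → ℂ) (e : ι → ℕ)
    (h : ∀ r : ℝ, 0 < r → r < 1 → Summable fun i => ‖c i‖ * r ^ e i) :
    ∃ F : ℂ⟦X⟧, HasSum (fun i => PowerSeries.monomial (e i) (c i)) F ∧
      ConvergesTo F fun q => ∑' i, c i * q ^ e i := by
  classical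
  -- Any fixed radius in `(0, 1)` would do: the terms with `e i = n` all carry the same factor
  -- `r^n`, which can be divided out.
  have hcoeff : ∀ n, Summable fun i => (PowerSeries.monomial (e i) (c i)).coeff n := by
    intro n
    refine Summable.of_norm_bounded
      ((h (1 / 2) (by norm_num) (by norm_num)).mul_right ((1 / 2 : ℝ) ^ n)⁻¹) fun i => ?_
    rw [PowerSeries.coeff_monomial]
    split_ifs with hn
    · rw [hn, mul_inv_cancel_right₀ (by positivity)]
    · rw [norm_zero]; positivity
  refine ⟨PowerSeries.mk fun n => ∑' i, (PowerSeries.monomial (e i) (c i)).coeff n, ?_, ?_⟩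
  · rw [PowerSeries.WithPiTopology.hasSum_iff_hasSum_coeff]
    intro n
    rw [PowerSeries.coeff_mk]
    exact (hcoeff n).hasSum
  · intro q hq
    obtain ⟨r, hqr, hr⟩ := exists_between hq
    have hr0 : 0 < r := (norm_nonneg q).trans_lt hqr
    -- Row `i` of this array has the single entry `c i * q ^ e i` at `n = e i`, and column `n` sums
    -- to the `n`-th term of the power series. Absolute summability at the radius `r > ‖q‖` allows
    -- the exchange.
    let a : ι × ℕ → ℂ := fun p => (PowerSeries.monomial (e p.1) (c p.1)).coeff p.2 * q ^ p.2
    have hrow : ∀ i, HasSum (fun n => a (i, n)) (c i * q ^ e i) := by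
      intro i
      have h1 := hasSum_single (f := fun n => a (i, n)) (e i) fun n hn => by
        simp [a, PowerSeries.coeff_monomial, hn]
      simpa [a, PowerSeries.coeff_monomial] using h1
    have hrow' : ∀ i, HasSum (fun n => ‖a (i, n)‖) ‖c i * q ^ e i‖ := by
      intro i
      have h1 := hasSum_single (f := fun n => ‖a (i, n)‖) (e i) fun n hn => by
        simp [a, PowerSeries.coeff_monomial, hn]
      simpa [a, PowerSeries.coeff_monomial] using h1
    have ha : Summable fun p => ‖a p‖ := by
      rw [summable_prod_of_nonneg fun p => norm_nonneg _]
      refine ⟨fun i => (hrow' i).summable, ?_⟩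
      simp_rw [fun i => (hrow' i).tsum_eq]
      refine (h r hr0 hr).of_nonneg_of_le (fun i => norm_nonneg _) fun i => ?_
      rw [norm_mul, norm_pow]
      gcongr
    have htot : HasSum a (∑' i, c i * q ^ e i) := by
      have := ha.of_norm.hasSum.prod_fiberwise hrow
      rw [this.tsum_eq]
      exact ha.of_norm.hasSum
    have hswap := (Equiv.prodComm ℕ ι).hasSum_iff.mpr htot
    have haswap : Summable fun p : ℕ × ι => ‖a p.swap‖ :=
      (Equiv.prodComm ℕ ι).summable_iff.mpr ha
    have hcol : ∀ n, (PowerSeries.mk fun n => ∑' i,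
        (PowerSeries.monomial (e i) (c i)).coeff n).coeff n * q ^ n = ∑' i, a (i, n) := by
      intro n
      rw [PowerSeries.coeff_mk, ← tsum_mul_right]
    simp_rw [hcol]
    refine ⟨?_, ?_⟩
    · exact haswap.prod.of_nonneg_of_le (fun n => norm_nonneg _)
        fun n => norm_tsum_le_tsum_norm (haswap.prod_factor n)
    · exact hswap.prod_fiberwise fun n => (haswap.of_norm.prod_factor n).hasSum

/-- Euler's product as a formal power series converges to Euler's product on the unit disc. -/
theorem convergesTo_eulerPhi {p : ℕ} (hp : 0 < p) :
    ConvergesTo (eulerPhi ((PowerSeries.X : ℂ⟦X⟧) ^ p)) fun q => eulerPhi (q ^ p) := by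
  -- Expanding the product over finite subsets `s` gives signed monomials, the same formally and
  -- numerically.
  let c : Finset ℕ → ℂ := fun s => ∏ _i ∈ s, (-1)
  let e : Finset ℕ → ℕ := fun s => ∑ i ∈ s, (p * i + p)
  have hprod : ∀ (q : ℂ) (s : Finset ℕ), c s * q ^ e s = ∏ i ∈ s, (-(q ^ p) ^ (i + 1)) := by
    intro q s
    simp only [c, e]
    rw [← prod_pow_eq_pow_sum, ← prod_mul_distrib]
    refine prod_congr rfl fun i _ => ?_
    rw [← pow_mul, neg_one_mul, Nat.mul_succ]
  have hprod' : ∀ s : Finset ℕ, PowerSeries.monomial (e s) (c s) =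
      ∏ i ∈ s, (-((PowerSeries.X : ℂ⟦X⟧) ^ p) ^ (i + 1)) := by
    intro s
    have hX : ∀ i : ℕ, -((PowerSeries.X : ℂ⟦X⟧) ^ p) ^ (i + 1) =
        PowerSeries.C (-1 : ℂ) * PowerSeries.X ^ (p * i + p) := fun i => by
      rw [← pow_mul, Nat.mul_succ, map_neg, map_one, neg_one_mul]
    simp_rw [hX]
    rw [prod_mul_distrib, prod_pow_eq_pow_sum, ← map_prod, PowerSeries.monomial_eq_C_mul_X_pow]
  have hnorm : ∀ q : ℂ, ‖q‖ < 1 → Summable fun i : ℕ => ‖-(q ^ p) ^ (i + 1)‖ := fun q hq => by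
    simpa using summable_norm_pow (norm_pow_lt_one hq hp) one_pos 1 1
  obtain ⟨F, hF, hconv⟩ := exists_hasSum_monomial c e (fun r hr0 hr => by
    have hr' : ‖(r : ℂ)‖ < 1 := by simpa [abs_of_pos hr0] using hr
    have h := summable_finsetProd_of_summable_nonneg (fun i => norm_nonneg _) (hnorm r hr')
    refine h.congr fun s => ?_
    rw [← norm_prod, ← hprod, norm_mul, norm_pow, Complex.norm_real, Real.norm_of_nonneg hr0.le])
  simp_rw [hprod'] at hF
  have hFeq : eulerPhi ((PowerSeries.X : ℂ⟦X⟧) ^ p) = F := by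
    have := (hasProd_one_add_of_hasSum_prod hF).tprod_eq
    simpa only [eulerPhi, sub_eq_add_neg] using this
  rw [hFeq]
  intro q hq
  have hval : ∑' s, c s * q ^ e s = eulerPhi (q ^ p) := by
    simp_rw [hprod]
    rw [← tprod_one_add (summable_finsetProd_of_summable_norm (hnorm q hq))]
    simp only [eulerPhi, sub_eq_add_neg]
  have := hconv q hq
  simpa only [hval] using this

theorem ConvergesTo.constantCoeff {F : ℂ⟦X⟧} {f : ℂ → ℂ} (hF : ConvergesTo F f) :
    PowerSeries.constantCoeff F = f 0 := by
  have h := (hF 0 (by simp)).2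
  have h1 := hasSum_single (f := fun n => F.coeff n * (0 : ℂ) ^ n) 0 fun n hn => by
    rw [zero_pow hn, mul_zero]
  simpa using h1.unique h

theorem eulerPhi_zero : eulerPhi (0 : ℂ) = 1 := by simp [eulerPhi]

theorem constantCoeff_eulerPhi {p : ℕ} (hp : 0 < p) :
    PowerSeries.constantCoeff (eulerPhi ((PowerSeries.X : ℂ⟦X⟧) ^ p)) = 1 := by
  rw [(convergesTo_eulerPhi hp).constantCoeff, zero_pow hp.ne', eulerPhi_zero]

theorem constantCoeff_eulerPhi_X :
    PowerSeries.constantCoeff (eulerPhi (PowerSeries.X : ℂ⟦X⟧)) = 1 := by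
  simpa using constantCoeff_eulerPhi one_pos

/-! ### The identity -/

theorem exists_hasSum_secondExponent {m : ℕ} (hm : 0 < m) :
    ∃ F : ℂ⟦X⟧, HasSum (fun k : Fin (4 * m - 1) → ℤ =>
        (PowerSeries.X : ℂ⟦X⟧) ^ (secondExponent m k).toNat) F ∧
      ConvergesTo F fun q => ∑' k : Fin (4 * m - 1) → ℤ, q ^ secondExponent m k := by
  have hpow : ∀ (q : ℂ) (k : Fin (4 * m - 1) → ℤ),
      q ^ (secondExponent m k).toNat = q ^ secondExponent m k := fun q k => by
    rw [← zpow_natCast, Int.toNat_of_nonneg (secondExponent_nonneg hm k)]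
  obtain ⟨F, hF, hconv⟩ := exists_hasSum_monomial (fun _ : Fin (4 * m - 1) → ℤ => 1)
    (fun k => (secondExponent m k).toNat) (fun r hr0 hr => by
      have hr' : ‖(r : ℂ)‖ < 1 := by simpa [abs_of_pos hr0] using hr
      have h := (hasSum_secondExponent hr' (by exact_mod_cast hr0.ne') hm).summable.norm
      refine h.congr fun k => ?_
      rw [← hpow, norm_pow, Complex.norm_real, Real.norm_of_nonneg hr0.le, norm_one, one_mul])
  refine ⟨F, by simpa [PowerSeries.monomial_eq_C_mul_X_pow] using hF, ?_⟩
  simpa only [one_mul, hpow] using hconv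

theorem secondProduct_mul_cancel {q : ℂ} (hq : ‖q‖ < 1) (m : ℕ) :
    secondProduct m q * (eulerPhi q ^ 2 * eulerPhi (q ^ 3)) =
      eulerPhi (q ^ (3 * m)) ^ (4 * m) * eulerPhi (q ^ 2) ^ 2 :=
  inv_mul_cancel_right₀ (mul_ne_zero (pow_ne_zero _ (eulerPhi_ne_zero hq))
    (eulerPhi_ne_zero (norm_pow_lt_one hq (by norm_num)))) _

/-- The identity is compared on the punctured disc with denominators cleared, since `ConvergesTo` is
established for products and powers only. The denominator has constant coefficient `1`, so it can be
divided out again. -/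
theorem hasSum_X_pow_secondExponent {m : ℕ} (hm : 0 < m) :
    HasSum (fun k : Fin (4 * m - 1) → ℤ =>
        (PowerSeries.X : ℂ⟦X⟧) ^ (secondExponent m k).toNat)
      (secondProduct m (PowerSeries.X : ℂ⟦X⟧)) := by
  obtain ⟨F, hF, hconv⟩ := exists_hasSum_secondExponent hm
  have h1 := convergesTo_eulerPhi one_pos
  simp only [pow_one] at h1
  have h3 := convergesTo_eulerPhi (p := 3) (by norm_num)
  have hmul : F * (eulerPhi PowerSeries.X ^ 2 * eulerPhi (PowerSeries.X ^ 3)) =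
      eulerPhi (PowerSeries.X ^ (3 * m)) ^ (4 * m) * eulerPhi (PowerSeries.X ^ 2) ^ 2 := by
    refine (hconv.mul ((h1.pow 2).mul h3)).unique
      (((convergesTo_eulerPhi (p := 3 * m) (by omega)).pow (4 * m)).mul
        ((convergesTo_eulerPhi (p := 2) two_pos).pow 2)) fun q hq hq0 => ?_
    rw [(hasSum_secondExponent hq hq0 hm).tsum_eq, secondProduct_mul_cancel hq]
  have hc : PowerSeries.constantCoeff
      (eulerPhi (PowerSeries.X : ℂ⟦X⟧) ^ 2 * eulerPhi (PowerSeries.X ^ 3)) ≠ 0 := by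
    simp [constantCoeff_eulerPhi_X, constantCoeff_eulerPhi]
  rwa [secondProduct, ← hmul, mul_assoc, PowerSeries.mul_inv_cancel _ hc, mul_one]

/-- The theta function argument divides by `q`, so it does not reach `q = 0`. Since `0 ^ e` is `1`
for `e = 0` and `0` for `e > 0`, the series at `q = 0` is the coefficient of `X ^ 0` in the formal
identity. -/
theorem hasSum_zero_zpow_secondExponent {m : ℕ} (hm : 0 < m) :
    HasSum (fun k : Fin (4 * m - 1) → ℤ => (0 : ℂ) ^ secondExponent m k)
      (secondProduct m (0 : ℂ)) := by
  have h := (PowerSeries.WithPiTopology.hasSum_iff_hasSum_coeff ℂ).mp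
    (hasSum_X_pow_secondExponent hm) 0
  have hleft : PowerSeries.coeff 0 (secondProduct m (PowerSeries.X : ℂ⟦X⟧)) = 1 := by
    rw [PowerSeries.coeff_zero_eq_constantCoeff_apply, secondProduct]
    simp [PowerSeries.constantCoeff_inv, constantCoeff_eulerPhi_X, constantCoeff_eulerPhi, hm]
  have hright : secondProduct m (0 : ℂ) = 1 := by
    rw [secondProduct, zero_pow (by omega), zero_pow two_ne_zero, zero_pow three_ne_zero,
      eulerPhi_zero]
    simp
  rw [hleft, ← hright] at h
  refine h.congr_fun fun k => ?_
  obtain ⟨n, hn⟩ := Int.eq_ofNat_of_zero_le (secondExponent_nonneg hm k)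
  rw [hn, Int.toNat_natCast, zpow_natCast, PowerSeries.coeff_X_pow, zero_pow_eq]
  simp only [eq_comm]

theorem secondExponent_one (k : Fin (4 * 1 - 1) → ℤ) :
    secondExponent 1 k = firstExponent 1 k := by
  have hc : ∀ i : Fin (4 * 1 - 1), linTildeCoeff 1 (i + 1) = linCoeff 1 (i + 1) := by decide
  simp only [secondExponent, firstExponent, linTilde, lin, hc]
  norm_num

/-- One of the four factors `φ(q³)` cancels against the denominator, leaving `φ(q³)³ φ(q²)² / φ(q)²`
on both sides. -/
theorem secondProduct_one_X :
    secondProduct 1 (PowerSeries.X : ℂ⟦X⟧) = firstProduct 1 (PowerSeries.X : ℂ⟦X⟧) := by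
  have h3 : PowerSeries.constantCoeff (eulerPhi ((PowerSeries.X : ℂ⟦X⟧) ^ 3)) ≠ 0 := by
    simp [constantCoeff_eulerPhi]
  simp only [secondProduct, firstProduct, mul_one, pow_one, Nat.add_one_sub_one]
  rw [PowerSeries.mul_inv_rev, ← sq]
  calc _ = eulerPhi ((PowerSeries.X : ℂ⟦X⟧) ^ 3) ^ 3 * eulerPhi (PowerSeries.X ^ 2) ^ 2 *
      (eulerPhi PowerSeries.X ^ 2)⁻¹ * (eulerPhi ((PowerSeries.X : ℂ⟦X⟧) ^ 3) *
      (eulerPhi ((PowerSeries.X : ℂ⟦X⟧) ^ 3))⁻¹) := by ring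
    _ = _ := by rw [PowerSeries.mul_inv_cancel _ h3, mul_one]

theorem secondProduct_one {q : ℂ} (hq : ‖q‖ < 1) : secondProduct 1 q = firstProduct 1 q := by
  have h3 : eulerPhi (q ^ 3) ≠ 0 := eulerPhi_ne_zero (norm_pow_lt_one hq (by norm_num))
  have h1 := eulerPhi_ne_zero hq
  simp only [secondProduct, firstProduct, mul_one, pow_one, Nat.reduceSub]
  field_simp

end GaussSeries

theorem mainTheorem2 (m : ℕ) (hm : 0 < m) :
    -- all exponents are nonnegative, so the series is a formal power series in `q`
    (∀ k : Fin (4 * m - 1) → ℤ, 0 ≤ GaussSeries.secondExponent m k) ∧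
    -- the identity of formal power series
    HasSum (fun k : Fin (4 * m - 1) → ℤ =>
        (PowerSeries.X : ℂ⟦X⟧) ^ (GaussSeries.secondExponent m k).toNat)
      (GaussSeries.secondProduct m (PowerSeries.X : ℂ⟦X⟧)) ∧
    -- the identity of analytic functions on the open unit disc
    (∀ q : ℂ, ‖q‖ < 1 →
      HasSum (fun k : Fin (4 * m - 1) → ℤ => q ^ GaussSeries.secondExponent m k)
        (GaussSeries.secondProduct m q)) ∧
    -- for `m = 1` both sides coincide with those of the first class
    (m = 1 →
      (∀ k : Fin (4 * m - 1) → ℤ,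
        GaussSeries.secondExponent m k = GaussSeries.firstExponent m k) ∧
      GaussSeries.secondProduct m (PowerSeries.X : ℂ⟦X⟧) =
        GaussSeries.firstProduct m (PowerSeries.X : ℂ⟦X⟧) ∧
      ∀ q : ℂ, ‖q‖ < 1 →
        GaussSeries.secondProduct m q = GaussSeries.firstProduct m q) := by
  refine ⟨GaussSeries.secondExponent_nonneg hm, GaussSeries.hasSum_X_pow_secondExponent hm,
    fun q hq => ?_, ?_⟩
  · rcases eq_or_ne q 0 with rfl | hq0
    · exact GaussSeries.hasSum_zero_zpow_secondExponent hm
    · exact GaussSeries.hasSum_secondExponent hq hq0 hm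
  · rintro rfl
    exact ⟨GaussSeries.secondExponent_one, GaussSeries.secondProduct_one_X,
      fun q hq => GaussSeries.secondProduct_one hq⟩
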